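/- Let $d\ge 1$. Call $x\in\mathbb R^d$ a \emph{Lebesgue point} of a function $g\colon\mathbb R^d\to\mathbb C$ if there is a number $c\in\mathbb C$ such that $r^{-d}\int_{\{|y|<r\}}|g(x-y)-c|\,dy\to 0$ as $r\to 0^+$. For a sequence $\theta=(\theta_j)_{j\ge 0}$ in $(0,1/2)$, let $E^{(1)}_\theta\subseteq[-\tfrac12,\tfrac12]$ be the Cantor set with dissection ratios $\theta_j$: start with $[-\tfrac12,\tfrac12]$, and at step $k=0,1,2,\dots$ remove from the middle of every remaining closed interval $W$ an open interval of length $(1-2\theta_k)|W|$, leaving two closed intervals of length $\theta_k|W|$; $E^{(1)}_\theta$ is the set of points that are never removed. Let $$E_\theta=\{(x_1,\dots,x_d)\in[-\tfrac12,\tfrac12]^d : x_i\in E^{(1)}_\theta\text{ for some }i\}.$$ Then there exist a function $f\colon\mathbb R^d\to\mathbb C$ that lies in $L^p(\mathbb R^d)$ for every $p\in(1,\infty]$, and dissection ratios $\theta_j\in(0,1/2)$, $j\ge 0$, such that the set $E_\theta$ is compact and has Hausdorff dimension $d$, and such that no point of $E_\theta$ is a Lebesgue point of the Fourier transform $\hat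 f$. Here $\hat f\in L^2(\mathbb R^d)$ is the Fourier transform of $f\in L^2(\mathbb R^d)$ in the sense of Plancherel, normalised by $\hat f(\xi)=\int f(x)e^{-2\pi i x\cdot\xi}\,dx$ for integrable $f$. -/

import Mathlib

open MeasureTheory Filter Topology Set
open scoped ENNReal FourierTransform

/-- `x` is a Lebesgue point of `g : ℝ^d → ℂ`: for some number `c`,
`r^{-d} ∫_{|y| < r} |g (x - y) - c| dy → 0` as `r → 0+`. The integral of the nonnegative integrand
is taken in `[0, ∞]`, so that it has its usual meaning for every measurable `g`. -/
def IsLebesguePoint {d : ℕ} (g : EuclideanSpace ℝ (Fin d) → ℂ)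
    (x : EuclideanSpace ℝ (Fin d)) : Prop :=
  ∃ c : ℂ, Tendsto
    (fun r : ℝ => ENNReal.ofReal ((r ^ d)⁻¹) *
      ∫⁻ y in Metric.ball (0 : EuclideanSpace ℝ (Fin d)) r, ‖g (x - y) - c‖ₑ)
    (𝓝[>] 0) (𝓝 0)

/-- `IsWhiteInterval θ k a b`: the interval `[a, b]` is one of the `2 ^ k` intervals that remain
after `k` steps of the Cantor construction with dissection ratios `θ 0, θ 1, …`. The construction
starts from `[-1/2, 1/2]`; step `k` removes from the middle of each remaining interval `[a, b]` the
open interval of length `(1 - 2 * θ k) * (b - a)`, which leaves two intervals of length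
`θ k * (b - a)`. -/
inductive IsWhiteInterval (θ : ℕ → ℝ) : ℕ → ℝ → ℝ → Prop
  | zero : IsWhiteInterval θ 0 (-(1 / 2)) (1 / 2)
  | left {k : ℕ} {a b : ℝ} (h : IsWhiteInterval θ k a b) :
      IsWhiteInterval θ (k + 1) a (a + θ k * (b - a))
  | right {k : ℕ} {a b : ℝ} (h : IsWhiteInterval θ k a b) :
      IsWhiteInterval θ (k + 1) (b - θ k * (b - a)) b

/-- The Cantor set in `[-1/2, 1/2]` with dissection ratios `θ 0, θ 1, …`. -/
def ratioCantorSet (θ : ℕ → ℝ) : Set ℝ :=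
  {t | ∀ k : ℕ, ∃ a b : ℝ, IsWhiteInterval θ k a b ∧ t ∈ Icc a b}

/-- The `d`-dimensional tensor version of the Cantor set: all points of the cube `[-1/2, 1/2]^d`
with at least one coordinate in the Cantor set. -/
def tensorCantorSet (d : ℕ) (θ : ℕ → ℝ) : Set (EuclideanSpace ℝ (Fin d)) :=
  {x | (∀ i, x i ∈ Icc (-(1 / 2) : ℝ) (1 / 2)) ∧ ∃ i, x i ∈ ratioCantorSet θ}

/-!
The Fourier transform is built as a divergent series of Riesz products. Let
`R_k(t) = ∏ j < k, (1 + cos (2 π N_j t)) / 2` with `N_j = freq j`, and let `g` be a bump function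
supported near the origin, so that `Re 𝓕 g > 0` on a large ball. The function
`𝓕 g x * R_k (x_i)` is the Fourier transform of a combination `rieszPiece g i k` of translates of
`g`. Passing from `k` to `k + 1` replaces a function `h` by
`h / 2 + (h (· - N_k e_i) + h (· + N_k e_i)) / 4`, and as the frequencies grow quickly the three
translates have disjoint supports. Hence the supremum is halved at each step while the `L¹` norm
does not increase, and by interpolation the `L^p` norms decay geometrically for every `p > 1`. So
the sum `f` of all these pieces lies in every such `L^p`.

By Plancherel, `𝓕 f = ∑ k, ∑ i, R_k (x_i) * 𝓕 g x` almost everywhere. On the large ball the real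
parts of all terms are nonnegative, so `Re 𝓕 f` dominates each partial sum, which is continuous.
At a point where the series of the real parts diverges, `Re 𝓕 f` therefore tends to infinity
(off a null set), and such a point is not a Lebesgue point. No control of averages at particular
scales is needed.

Divergence holds wherever some `R_k (x_i)` stays bounded below, that is, where `N_j x_i` is close to
an integer for all `j` with summable squared errors. The interval lengths `len` are chosen such that
this is so on the Cantor set: they are integer multiples of `1 / N_j` below the level `2 ^ (j + 1)`,
where the length is much smaller than `1 / N_j` (`exists_int_abs_freq_mul_sub_le`). The loss
of length at these exceptional levels is subexponential in the level, so the Cantor function is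
Hölder continuous with every exponent `α < 1`. Applied to one coordinate it maps a part of the
tensor Cantor set onto a set with interior points, whence the dimension is `d`
(`mul_le_dimH_tensorCantorSet`).
-/

/-! ### Interval lengths and frequencies -/

/-- The length of the intervals that remain after `i` steps of the dissection. The levels are
grouped into the blocks `2 ^ (J - 1) ≤ i < 2 ^ J`, where `J = Nat.size i`. Inside a block the
lengths are almost halved at each step; at the transition to block `J + 1` there is an additional
loss of a factor about `2 ^ (2 * J + 1)`. -/
noncomputable def len (i : ℕ) : ℝ :=
  2 * ((1 / 2) ^ (i + i.size ^ 2) - (1 / 2) ^ (2 ^ i.size + i.size ^ 2))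

/-- The frequencies of the Riesz products. All interval lengths up to the end of block `k + 1` are
integer multiples of `1 / freq k`. -/
def freq (k : ℕ) : ℕ := 2 ^ (2 ^ (k + 1) + (k + 1) ^ 2)

lemma len_zero : len 0 = 1 := by norm_num [len]

lemma half_pow_le_len (i : ℕ) : (1 / 2 : ℝ) ^ (i + i.size ^ 2) ≤ len i := by
  have h : (1 / 2 : ℝ) ^ (2 ^ i.size + i.size ^ 2) ≤ (1 / 2) ^ (i + i.size ^ 2 + 1) :=
    pow_le_pow_of_le_one (by norm_num) (by norm_num) (by have := Nat.lt_size_self i; omega)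
  rw [pow_succ _ (i + i.size ^ 2)] at h
  unfold len
  linarith

lemma len_pos (i : ℕ) : 0 < len i := lt_of_lt_of_le (by positivity) (half_pow_le_len i)

lemma len_lt (i : ℕ) : len i < 2 * (1 / 2) ^ (i + i.size ^ 2) := by
  have : (0 : ℝ) < (1 / 2) ^ (2 ^ i.size + i.size ^ 2) := by positivity
  unfold len
  linarith

lemma two_mul_len_succ_lt (i : ℕ) : 2 * len (i + 1) < len i := by
  rcases (Nat.size_le_size (Nat.le_succ i)).eq_or_lt with h | h
  · have : (0 : ℝ) < (1 / 2) ^ (2 ^ i.size + i.size ^ 2) := by positivity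
    unfold len
    rw [Nat.succ_eq_add_one] at h
    rw [← h, show i + 1 + i.size ^ 2 = i + i.size ^ 2 + 1 by ring, pow_succ]
    linarith
  · have h1 := len_lt (i + 1)
    have h2 : (1 / 2 : ℝ) ^ (i + 1 + (i + 1).size ^ 2) ≤ (1 / 2) ^ (i + i.size ^ 2 + 2) := by
      refine pow_le_pow_of_le_one (by norm_num) (by norm_num) ?_
      have h' : i.size + 1 ≤ (i + 1).size := h
      nlinarith
    have h3 := half_pow_le_len i
    have h4 : (1 / 2 : ℝ) ^ (i + i.size ^ 2 + 2) = (1 / 2) ^ (i + i.size ^ 2) / 4 := by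
      rw [pow_add]; norm_num; ring
    linarith

lemma len_succ_lt (i : ℕ) : len (i + 1) < len i := by
  have := two_mul_len_succ_lt i
  have := len_pos (i + 1)
  linarith

lemma len_le_half_pow (i : ℕ) : len i ≤ (1 / 2) ^ i := by
  induction i with
  | zero => simp [len_zero]
  | succ i ih =>
    have := two_mul_len_succ_lt i
    rw [pow_succ]
    linarith

/-- Both powers of `1 / 2` in the definition of `len i` have exponent at most
`2 ^ (k + 1) + (k + 1) ^ 2` as long as `i` belongs to one of the blocks up to block `k + 1`. -/
lemma exists_int_eq_freq_mul_len {k i : ℕ} (hi : i < 2 ^ (k + 1)) :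
    ∃ n : ℤ, (freq k : ℝ) * len i = n := by
  have hs : i.size ≤ k + 1 := Nat.size_le.2 hi
  have hs2 : i.size ^ 2 ≤ (k + 1) ^ 2 := Nat.pow_le_pow_left hs 2
  have key : ∀ a : ℕ, a ≤ 2 ^ (k + 1) + (k + 1) ^ 2 →
      ∃ n : ℤ, (freq k : ℝ) * (1 / 2) ^ a = n := by
    intro a ha
    refine ⟨2 ^ (2 ^ (k + 1) + (k + 1) ^ 2 - a), ?_⟩
    obtain ⟨b, hb⟩ := Nat.exists_eq_add_of_le ha
    have : (2 : ℝ) ^ a * (1 / 2) ^ a = 1 := by rw [← mul_pow]; norm_num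
    simp only [freq, hb, Nat.add_sub_cancel_left]
    push_cast
    rw [pow_add]
    linear_combination (2 : ℝ) ^ b * this
  obtain ⟨m, hm⟩ := key (i + i.size ^ 2) (by omega)
  obtain ⟨n, hn⟩ := key (2 ^ i.size + i.size ^ 2)
    (add_le_add (Nat.pow_le_pow_right (by norm_num) hs) hs2)
  refine ⟨2 * (m - n), ?_⟩
  push_cast
  rw [← hm, ← hn, len]
  ring

lemma freq_mul_len_le (k : ℕ) : (freq k : ℝ) * len (2 ^ (k + 1)) ≤ (1 / 4) ^ (k + 1) := by
  have h := (len_lt (2 ^ (k + 1))).le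
  rw [Nat.size_pow] at h
  have hf : (0 : ℝ) ≤ freq k := by positivity
  refine (mul_le_mul_of_nonneg_left h hf).trans (le_of_eq ?_)
  rw [show 2 ^ (k + 1) + (k + 1 + 1) ^ 2 = (2 ^ (k + 1) + (k + 1) ^ 2) + (2 * (k + 1) + 1) by ring,
    pow_add, freq]
  have : (2 : ℝ) ^ (2 ^ (k + 1) + (k + 1) ^ 2) * (1 / 2) ^ (2 ^ (k + 1) + (k + 1) ^ 2) = 1 := by
    rw [← mul_pow]; norm_num
  push_cast
  rw [pow_succ _ (2 * (k + 1)), pow_mul]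
  norm_num at this ⊢
  linear_combination (1 / 4 : ℝ) ^ (k + 1) * this

lemma two_dvd_freq (k : ℕ) : 2 ∣ freq k := dvd_pow_self 2 (by positivity)

lemma eight_le_freq (k : ℕ) : 8 ≤ freq k := by
  change 2 ^ 3 ≤ _
  refine Nat.pow_le_pow_right (by norm_num) ?_
  have h1 : 2 ^ 1 ≤ 2 ^ (k + 1) := Nat.pow_le_pow_right (by norm_num) (by omega)
  have h2 : 0 < (k + 1) ^ 2 := by positivity
  omega

lemma four_mul_freq_le (k : ℕ) : 4 * freq k ≤ freq (k + 1) := by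
  rw [freq, freq, show 4 = 2 ^ 2 by norm_num, ← pow_add]
  refine Nat.pow_le_pow_right (by norm_num) ?_
  have h1 : 2 ^ (k + 1) ≤ 2 ^ (k + 1 + 1) := Nat.pow_le_pow_right (by norm_num) (by omega)
  have h2 : (k + 1 + 1) ^ 2 = (k + 1) ^ 2 + 2 * k + 3 := by ring
  omega

/-- The dissection ratios that produce the interval lengths `len`. -/
noncomputable def ratio (i : ℕ) : ℝ := len (i + 1) / len i

lemma ratio_mem (i : ℕ) : ratio i ∈ Ioo (0 : ℝ) (1 / 2) := by
  refine ⟨div_pos (len_pos _) (len_pos _), ?_⟩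
  rw [ratio, div_lt_iff₀ (len_pos _)]
  linarith [two_mul_len_succ_lt i]

lemma ratio_mul_len (i : ℕ) : ratio i * len i = len (i + 1) :=
  div_mul_cancel₀ _ (len_pos i).ne'

/-! ### Coding the Cantor set -/

lemma IsWhiteInterval.eq_of_zero {θ : ℕ → ℝ} {a b : ℝ} (h : IsWhiteInterval θ 0 a b) :
    a = -(1 / 2) ∧ b = 1 / 2 := by
  have aux : ∀ {k : ℕ}, IsWhiteInterval θ k a b → k = 0 → a = -(1 / 2) ∧ b = 1 / 2 := by
    intro k h hk
    cases h with
    | zero => exact ⟨rfl, rfl⟩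
    | left => omega
    | right => omega
  exact aux h rfl

lemma IsWhiteInterval.sub_eq_len {k : ℕ} {a b : ℝ} (h : IsWhiteInterval ratio k a b) :
    b - a = len k := by
  induction h with
  | zero => rw [len_zero]; norm_num
  | left h ih => rw [ih, ratio_mul_len]; ring
  | right h ih => rw [ih, ratio_mul_len]; ring

lemma isWhiteInterval_left {k : ℕ} {a : ℝ} (h : IsWhiteInterval ratio k a (a + len k)) :
    IsWhiteInterval ratio (k + 1) a (a + len (k + 1)) := by
  have := h.left
  rwa [add_sub_cancel_left, ratio_mul_len] at this

lemma isWhiteInterval_right {k : ℕ} {a : ℝ} (h : IsWhiteInterval ratio k a (a + len k)) :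
    IsWhiteInterval ratio (k + 1) (a + (len k - len (k + 1)))
      (a + (len k - len (k + 1)) + len (k + 1)) := by
  have := h.right
  rw [add_sub_cancel_left, ratio_mul_len] at this
  convert this using 1 <;> ring

lemma IsWhiteInterval.exists_parent {k : ℕ} {a b : ℝ} (h : IsWhiteInterval ratio (k + 1) a b) :
    ∃ a', IsWhiteInterval ratio k a' (a' + len k) ∧ (a = a' ∨ a = a' + (len k - len (k + 1))) := by
  cases h with
  | @left _ _ b' h =>
    have := h.sub_eq_len
    obtain rfl : b' = a + len k := by linarith
    exact ⟨a, h, Or.inl rfl⟩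
  | @right _ a' _ h =>
    have := h.sub_eq_len
    obtain rfl : b = a' + len k := by linarith
    refine ⟨a', h, Or.inr ?_⟩
    rw [this, ratio_mul_len]; ring

/-- White intervals of the same level are disjoint. -/
lemma IsWhiteInterval.left_unique {k : ℕ} {t : ℝ} : ∀ {a b a' b' : ℝ},
    IsWhiteInterval ratio k a b → IsWhiteInterval ratio k a' b' → t ∈ Icc a b → t ∈ Icc a' b' →
    a = a' := by
  induction k with
  | zero =>
    intro a b a' b' h h' _ _
    rw [h.eq_of_zero.1, h'.eq_of_zero.1]
  | succ k ih =>
    intro a b a' b' h h' ht ht'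
    have hl := h.sub_eq_len
    have hl' := h'.sub_eq_len
    obtain ⟨c, hc, hca⟩ := h.exists_parent
    obtain ⟨c', hc', hca'⟩ := h'.exists_parent
    have h1 := len_pos (k + 1)
    have h2 := two_mul_len_succ_lt k
    obtain ⟨ht1, ht2⟩ := ht
    obtain ⟨ht1', ht2'⟩ := ht'
    have hcc : c = c' := by
      refine ih hc hc' ⟨?_, ?_⟩ ⟨?_, ?_⟩ <;> rcases hca with rfl | rfl <;>
        rcases hca' with rfl | rfl <;> linarith
    subst hcc
    rcases hca with rfl | rfl <;> rcases hca' with rfl | rfl <;> linarith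

/-- The left endpoint of the white interval of level `k` that is reached by going to the left child
at step `i` if `ε i = 0` and to the right child if `ε i = 1`. -/
noncomputable def codeLeft (ε : ℕ → ℤ) (k : ℕ) : ℝ :=
  -(1 / 2) + ∑ i ∈ Finset.range k, (ε i : ℝ) * (len i - len (i + 1))

/-- The position, counted from the left and starting with `0`, of the white interval with left
endpoint `codeLeft ε k` among the `2 ^ k` white intervals of level `k`. -/
def codeIndex (ε : ℕ → ℤ) : ℕ → ℤ
  | 0 => 0
  | k + 1 => 2 * codeIndex ε k + ε k

lemma codeLeft_succ (ε : ℕ → ℤ) (k : ℕ) :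
    codeLeft ε (k + 1) = codeLeft ε k + ε k * (len k - len (k + 1)) := by
  simp only [codeLeft, Finset.sum_range_succ]; ring

lemma isWhiteInterval_codeLeft {ε : ℕ → ℤ} (hε : ∀ i, ε i = 0 ∨ ε i = 1) (k : ℕ) :
    IsWhiteInterval ratio k (codeLeft ε k) (codeLeft ε k + len k) := by
  induction k with
  | zero =>
    have := IsWhiteInterval.zero (θ := ratio)
    simp only [codeLeft, Finset.range_zero, Finset.sum_empty, add_zero, len_zero]
    convert this using 1; norm_num
  | succ k ih =>
    rw [codeLeft_succ]
    rcases hε k with h | h <;> rw [h]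
    · simpa using isWhiteInterval_left ih
    · simpa using isWhiteInterval_right ih

lemma exists_code_of_mem_ratioCantorSet {t : ℝ} (ht : t ∈ ratioCantorSet ratio) :
    ∃ ε : ℕ → ℤ, (∀ i, ε i = 0 ∨ ε i = 1) ∧
      ∀ k, t ∈ Icc (codeLeft ε k) (codeLeft ε k + len k) := by
  choose a b hw hm using ht
  have hb : ∀ k, b k = a k + len k := fun k => by linarith [(hw k).sub_eq_len]
  -- by disjointness, the parent of the interval chosen at level `k + 1` is the one at level `k`
  have step : ∀ k, ∃ e : ℤ, (e = 0 ∨ e = 1) ∧ a (k + 1) = a k + e * (len k - len (k + 1)) := by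
    intro k
    obtain ⟨c, hc, hca⟩ := (hw (k + 1)).exists_parent
    have hm' := hm (k + 1)
    rw [hb] at hm'
    have hcc : c = a k := by
      have := len_succ_lt k
      refine IsWhiteInterval.left_unique hc (hw k) (t := t) ⟨?_, ?_⟩ (hm k) <;>
        rcases hca with h | h <;> linarith [hm'.1, hm'.2]
    subst hcc
    rcases hca with h | h
    · exact ⟨0, Or.inl rfl, by simpa using h⟩
    · exact ⟨1, Or.inr rfl, by simpa using h⟩
  choose ε hε hstep using step
  have ha : ∀ k, codeLeft ε k = a k := by
    intro k
    induction k with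
    | zero =>
      rw [(hw 0).eq_of_zero.1]; simp [codeLeft]
    | succ k ih => rw [codeLeft_succ, ih, hstep]
  exact ⟨ε, hε, fun k => by rw [ha, ← hb]; exact hm k⟩

lemma mem_ratioCantorSet_of_code {t : ℝ} {ε : ℕ → ℤ} (hε : ∀ i, ε i = 0 ∨ ε i = 1)
    (ht : ∀ k, t ∈ Icc (codeLeft ε k) (codeLeft ε k + len k)) : t ∈ ratioCantorSet ratio :=
  fun k => ⟨_, _, isWhiteInterval_codeLeft hε k, ht k⟩

lemma exists_mem_of_code {ε : ℕ → ℤ} (hε : ∀ i, ε i = 0 ∨ ε i = 1) :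
    ∃ t, ∀ k, t ∈ Icc (codeLeft ε k) (codeLeft ε k + len k) := by
  have hanti : Antitone fun k => Icc (codeLeft ε k) (codeLeft ε k + len k) := by
    refine antitone_nat_of_succ_le fun k => Icc_subset_Icc ?_ ?_ <;> rw [codeLeft_succ] <;>
      have := len_succ_lt k <;> rcases hε k with h | h <;> rw [h] <;> push_cast <;> linarith
  have h := ciSup_mem_iInter_Icc_of_antitone_Icc hanti
    (fun k => by have := len_pos k; linarith)
  exact ⟨_, fun k => mem_iInter.1 h k⟩

/-- The frequencies resonate with the Cantor set: `freq k * t` is very close to an integer for each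
of its points `t`. -/
lemma exists_int_abs_freq_mul_sub_le {t : ℝ} (ht : t ∈ ratioCantorSet ratio) (k : ℕ) :
    ∃ n : ℤ, |freq k * t - n| ≤ (1 / 4) ^ (k + 1) := by
  obtain ⟨ε, hε, hc⟩ := exists_code_of_mem_ratioCantorSet ht
  obtain ⟨m, hm⟩ := Nat.exists_eq_succ_of_ne_zero (pow_pos two_pos (k + 1) : 0 < 2 ^ (k + 1)).ne'
  have hint : ∀ i ≤ m, ∃ n : ℤ, (freq k : ℝ) * codeLeft ε i = n := by
    intro i
    induction i with
    | zero =>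
      intro _
      obtain ⟨c, hc⟩ := two_dvd_freq k
      refine ⟨-c, ?_⟩
      simp [codeLeft, hc]; ring
    | succ i ih =>
      intro hi
      obtain ⟨n, hn⟩ := ih (by omega)
      obtain ⟨p, hp⟩ := exists_int_eq_freq_mul_len (k := k) (i := i) (by omega)
      obtain ⟨q, hq⟩ := exists_int_eq_freq_mul_len (k := k) (i := i + 1) (by omega)
      refine ⟨n + ε i * (p - q), ?_⟩
      push_cast
      rw [codeLeft_succ, ← hn, ← hp, ← hq]; ring
  obtain ⟨n, hn⟩ := hint m le_rfl
  obtain ⟨p, hp⟩ := exists_int_eq_freq_mul_len (k := k) (i := m) (by omega)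
  have hf : (0 : ℝ) < freq k := by have := eight_le_freq k; positivity
  have hle := freq_mul_len_le k
  have htm := hc (m + 1)
  have hmm : m + 1 = 2 ^ (k + 1) := hm.symm
  rw [codeLeft_succ, hmm] at htm
  have h1 := mul_le_mul_of_nonneg_left htm.1 hf.le
  have h2 := mul_le_mul_of_nonneg_left htm.2 hf.le
  -- the interval of level `m + 1 = 2 ^ (k + 1)` that contains `t` is short, and it shares an
  -- endpoint with its parent; both endpoints of the parent are multiples of `1 / freq k`
  rcases hε m with h | h <;> rw [h] at h1 h2 <;> push_cast at h1 h2
  · refine ⟨n, abs_le.2 ⟨?_, ?_⟩⟩ <;>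
      nlinarith [len_pos (2 ^ (k + 1)), mul_pos hf (len_pos (2 ^ (k + 1)))]
  · refine ⟨n + p, abs_le.2 ⟨?_, ?_⟩⟩ <;> push_cast <;>
      nlinarith [len_pos (2 ^ (k + 1)), mul_pos hf (len_pos (2 ^ (k + 1)))]

lemma finite_isWhiteInterval (θ : ℕ → ℝ) (k : ℕ) :
    {p : ℝ × ℝ | IsWhiteInterval θ k p.1 p.2}.Finite := by
  induction k with
  | zero =>
    refine (finite_singleton ((-(1 / 2), 1 / 2) : ℝ × ℝ)).subset ?_
    rintro ⟨a, b⟩ h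
    exact Prod.ext h.eq_of_zero.1 h.eq_of_zero.2
  | succ k ih =>
    refine ((ih.image fun p => (p.1, p.1 + θ k * (p.2 - p.1))).union
      (ih.image fun p => (p.2 - θ k * (p.2 - p.1), p.2))).subset ?_
    rintro ⟨a, b⟩ (h : IsWhiteInterval θ (k + 1) a b)
    cases h with
    | @left _ _ b' h => exact Or.inl ⟨(a, b'), h, rfl⟩
    | @right _ a' _ h => exact Or.inr ⟨(a', b), h, rfl⟩

lemma isClosed_ratioCantorSet (θ : ℕ → ℝ) : IsClosed (ratioCantorSet θ) := by
  have : ratioCantorSet θ =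
      ⋂ k, ⋃ p ∈ {p : ℝ × ℝ | IsWhiteInterval θ k p.1 p.2}, Icc p.1 p.2 := by
    ext t
    simp only [ratioCantorSet, mem_ofPred_eq, mem_iInter, mem_iUnion, exists_prop, Prod.exists]
  rw [this]
  exact isClosed_iInter fun k => (finite_isWhiteInterval θ k).isClosed_biUnion
    fun p _ => isClosed_Icc

lemma isCompact_tensorCantorSet (d : ℕ) (θ : ℕ → ℝ) : IsCompact (tensorCantorSet d θ) := by
  have hc : ∀ i : Fin d, Continuous fun x : EuclideanSpace ℝ (Fin d) => x i := fun i => by fun_prop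
  have hcube : IsCompact {x : EuclideanSpace ℝ (Fin d) | ∀ i, x i ∈ Icc (-(1 / 2) : ℝ) (1 / 2)} := by
    have := (isCompact_univ_pi fun _ : Fin d => isCompact_Icc (a := (-(1 / 2) : ℝ)) (b := 1 / 2))
    convert (EuclideanSpace.equiv (Fin d) ℝ).symm.toHomeomorph.isCompact_image.2 this using 1
    ext x
    constructor
    · intro h
      exact ⟨x.ofLp, fun i _ => h i, by rfl⟩
    · rintro ⟨y, hy, rfl⟩ i
      exact hy i trivial
  refine hcube.inter_right ?_
  have : {x : EuclideanSpace ℝ (Fin d) | ∃ i, x i ∈ ratioCantorSet θ} =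
      ⋃ i, (fun x : EuclideanSpace ℝ (Fin d) => x i) ⁻¹' ratioCantorSet θ := by
    ext; simp
  change IsClosed {x : EuclideanSpace ℝ (Fin d) | ∃ i, x i ∈ ratioCantorSet θ}
  rw [this]
  exact isClosed_iUnion_of_finite fun i => (isClosed_ratioCantorSet θ).preimage (hc i)

/-! ### The Cantor function and the Hausdorff dimension -/

/-- The graph of the Cantor function of the Cantor set with ratios `ratio`: `t` is the point with
code `ε`, and `s` is the number in `[0, 1]` with binary digits `ε`. -/
def CantorRel (t s : ℝ) : Prop :=
  ∃ ε : ℕ → ℤ, (∀ i, ε i = 0 ∨ ε i = 1) ∧ ∀ k, t ∈ Icc (codeLeft ε k) (codeLeft ε k + len k) ∧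
    2 ^ k * s ∈ Icc (codeIndex ε k : ℝ) (codeIndex ε k + 1)

lemma exists_cantorRel_of_mem {t : ℝ} (ht : t ∈ ratioCantorSet ratio) : ∃ s, CantorRel t s := by
  obtain ⟨ε, hε, hc⟩ := exists_code_of_mem_ratioCantorSet ht
  have hanti : Antitone fun k =>
      Icc ((codeIndex ε k : ℝ) / 2 ^ k) (((codeIndex ε k : ℝ) + 1) / 2 ^ k) := by
    refine antitone_nat_of_succ_le fun k => Icc_subset_Icc ?_ ?_ <;>
      rw [div_le_div_iff₀ (by positivity) (by positivity), codeIndex, pow_succ] <;>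
      have : (0 : ℝ) < 2 ^ k := by positivity
    all_goals rcases hε k with h | h <;> rw [h] <;> push_cast <;> nlinarith
  have h := ciSup_mem_iInter_Icc_of_antitone_Icc hanti
    (fun k => div_le_div_of_nonneg_right (by linarith) (by positivity))
  refine ⟨⨆ n, (codeIndex ε n : ℝ) / 2 ^ n, ε, hε, fun k => ⟨hc k, ?_⟩⟩
  have hk := mem_iInter.1 h k
  rw [mem_Icc, div_le_iff₀' (by positivity), le_div_iff₀' (by positivity)] at hk
  exact hk

lemma exists_cantorRel_of_mem_Ico {s : ℝ} (hs : s ∈ Ico (0 : ℝ) 1) :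
    ∃ t ∈ ratioCantorSet ratio, CantorRel t s := by
  -- the binary digits of `s`
  set ε : ℕ → ℤ := fun k => ⌊2 ^ (k + 1) * s⌋ - 2 * ⌊2 ^ k * s⌋ with hεdef
  have hε : ∀ i, ε i = 0 ∨ ε i = 1 := by
    intro i
    have h1 := Int.floor_le ((2 : ℝ) ^ i * s)
    have h2 := Int.lt_floor_add_one ((2 : ℝ) ^ i * s)
    have h3 : 2 * ⌊(2 : ℝ) ^ i * s⌋ ≤ ⌊(2 : ℝ) ^ (i + 1) * s⌋ := by
      rw [Int.le_floor, pow_succ]; push_cast; linarith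
    have h4 : ⌊(2 : ℝ) ^ (i + 1) * s⌋ < 2 * ⌊(2 : ℝ) ^ i * s⌋ + 2 := by
      rw [Int.floor_lt, pow_succ]; push_cast; linarith
    simp only [hεdef]
    omega
  have hidx : ∀ k, codeIndex ε k = ⌊2 ^ k * s⌋ := by
    intro k
    induction k with
    | zero => simp [codeIndex, (Int.floor_eq_zero_iff.2 hs)]
    | succ k ih => rw [codeIndex, ih]; simp only [hεdef]; ring
  obtain ⟨t, ht⟩ := exists_mem_of_code hε
  refine ⟨t, mem_ratioCantorSet_of_code hε ht, ε, hε, fun k => ⟨ht k, ?_⟩⟩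
  rw [hidx]
  exact ⟨Int.floor_le _, (Int.lt_floor_add_one _).le⟩

/-- Two white intervals of level `k` whose positions differ by `n` are at least as far apart as if
all white intervals between them were adjacent. -/
lemma codeIndex_sub_mul_len_le {ε ε' : ℕ → ℤ} (hε : ∀ i, ε i = 0 ∨ ε i = 1)
    (hε' : ∀ i, ε' i = 0 ∨ ε' i = 1) (k : ℕ) (h : codeIndex ε' k ≤ codeIndex ε k) :
    ((codeIndex ε k - codeIndex ε' k : ℤ) : ℝ) * len k ≤ codeLeft ε k - codeLeft ε' k := by
  induction k with
  | zero => simp [codeIndex, codeLeft]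
  | succ k ih =>
    simp only [codeIndex] at h
    have hle : codeIndex ε' k ≤ codeIndex ε k := by
      rcases hε k with h1 | h1 <;> rcases hε' k with h2 | h2 <;> omega
    have hle' : 0 ≤ codeIndex ε k - codeIndex ε' k + (ε k - ε' k) := by
      rcases hε k with h1 | h1 <;> rcases hε' k with h2 | h2 <;> omega
    have ih := ih hle
    have hle'' : (0 : ℝ) ≤ ((codeIndex ε k - codeIndex ε' k + (ε k - ε' k) : ℤ) : ℝ) := by
      exact_mod_cast hle'
    have hgap := two_mul_len_succ_lt k
    have := mul_nonneg hle'' (sub_nonneg.2 hgap.le)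
    rw [codeLeft_succ, codeLeft_succ]
    simp only [codeIndex]
    push_cast at ih this ⊢
    linarith

lemma CantorRel.sub_le {t t' s s' : ℝ} (h : CantorRel t s) (h' : CantorRel t' s') {k : ℕ}
    (htt : t - t' < len k) : s - s' ≤ 2 * (1 / 2) ^ k := by
  obtain ⟨ε, hε, hc⟩ := h
  obtain ⟨ε', hε', hc'⟩ := h'
  obtain ⟨⟨ht1, ht2⟩, hs1, hs2⟩ := hc k
  obtain ⟨⟨ht1', ht2'⟩, hs1', hs2'⟩ := hc' k
  have hidx : codeIndex ε k - codeIndex ε' k ≤ 1 := by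
    by_contra! hcon
    have h1 := codeIndex_sub_mul_len_le hε hε' k (by omega)
    have h2 : (2 : ℝ) ≤ ((codeIndex ε k - codeIndex ε' k : ℤ) : ℝ) := by
      exact_mod_cast hcon
    have := mul_le_mul_of_nonneg_right h2 (len_pos k).le
    linarith
  have hidx' : (codeIndex ε k : ℝ) - codeIndex ε' k ≤ 1 := by exact_mod_cast hidx
  have h1 : 2 ^ k * (s - s') ≤ 2 := by linarith
  have h2 : (2 : ℝ) ^ k * (1 / 2) ^ k = 1 := by rw [← mul_pow]; norm_num
  have h3 : (0 : ℝ) < (1 / 2) ^ k := by positivity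
  have := mul_le_mul_of_nonneg_left h1 h3.le
  linear_combination this + (s' - s) * h2

lemma CantorRel.abs_sub_le {t t' s s' : ℝ} (h : CantorRel t s) (h' : CantorRel t' s') {k : ℕ}
    (htt : |t - t'| < len k) : |s - s'| ≤ 2 * (1 / 2) ^ k := by
  rw [abs_lt] at htt
  rw [abs_le]
  have h1 := h.sub_le h' htt.2
  have h2 := h'.sub_le h (k := k) (by linarith)
  constructor <;> linarith

lemma CantorRel.unique {t s s' : ℝ} (h : CantorRel t s) (h' : CantorRel t s') : s = s' := by
  have hlim : Tendsto (fun k : ℕ => 2 * (1 / 2 : ℝ) ^ k) atTop (𝓝 (2 * 0)) :=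
    (tendsto_pow_atTop_nhds_zero_of_lt_one (by norm_num) (by norm_num)).const_mul 2
  have : |s - s'| ≤ 2 * 0 := ge_of_tendsto' hlim fun k => h.abs_sub_le h' (by simpa using len_pos k)
  rw [mul_zero] at this
  exact sub_eq_zero.1 (abs_nonpos_iff.1 this)

lemma CantorRel.mem_Icc {t s : ℝ} (h : CantorRel t s) : s ∈ Icc (0 : ℝ) 1 := by
  obtain ⟨ε, _, hc⟩ := h
  simpa [codeIndex] using (hc 0).2

/-- The interval lengths decay like `2 ^ (-n)` up to a subexponential factor. -/
lemma exists_half_pow_le_mul_len_rpow {α : ℝ} (h0 : 0 < α) (h1 : α < 1) :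
    ∃ C : ℝ, 0 < C ∧ ∀ n, (1 / 2 : ℝ) ^ n ≤ C * len n ^ α := by
  have hlim := tendsto_pow_const_div_const_pow_of_one_lt 2 (one_lt_two : (1 : ℝ) < 2)
  obtain ⟨K, hK⟩ := eventually_atTop.1
    (hlim.eventually (gt_mem_nhds (show 0 < (1 - α) / 2 by linarith)))
  have hsq : ∀ n : ℕ, ((n.size : ℝ)) ^ 2 ≤ (1 - α) * n + K ^ 2 := by
    intro n
    have hn0 : (0 : ℝ) ≤ (1 - α) * n := mul_nonneg (by linarith) (by positivity)
    rcases Nat.eq_zero_or_pos n with rfl | hn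
    · simp
    by_cases hc : K ≤ n.size
    · have h2 := hK _ hc
      rw [div_lt_iff₀ (by positivity)] at h2
      have h3 : (2 : ℝ) ^ n.size ≤ 2 * n := by
        obtain ⟨m, hm⟩ := Nat.exists_eq_succ_of_ne_zero (Nat.size_pos.2 hn).ne'
        have : 2 ^ m ≤ n := Nat.lt_size.1 (by omega)
        rw [hm, pow_succ, mul_comm]
        exact_mod_cast Nat.mul_le_mul_left 2 this
      have h4 := mul_le_mul_of_nonneg_left h3 (show 0 ≤ (1 - α) / 2 by linarith)
      have : (0 : ℝ) ≤ (K : ℝ) ^ 2 := by positivity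
      linarith
    · have : (n.size : ℝ) ≤ K := by exact_mod_cast (not_le.1 hc).le
      have : (n.size : ℝ) ^ 2 ≤ (K : ℝ) ^ 2 := by gcongr
      linarith
  refine ⟨2 ^ ((K : ℝ) ^ 2), by positivity, fun n => ?_⟩
  have hlen : ((1 / 2 : ℝ) ^ (n + n.size ^ 2)) ^ α ≤ len n ^ α :=
    Real.rpow_le_rpow (by positivity) (half_pow_le_len n) h0.le
  refine le_trans ?_ (mul_le_mul_of_nonneg_left hlen (by positivity))
  have e1 : (1 / 2 : ℝ) ^ n = (2 : ℝ) ^ (-(n : ℝ)) := by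
    rw [Real.rpow_neg (by norm_num), Real.rpow_natCast, one_div, inv_pow]
  have e2 : ((1 / 2 : ℝ) ^ (n + n.size ^ 2)) ^ α = (2 : ℝ) ^ (-((n : ℝ) + n.size ^ 2) * α) := by
    rw [Real.rpow_mul (by norm_num), Real.rpow_neg (by norm_num), one_div, inv_pow]
    congr 2
    rw [← Real.rpow_natCast]; push_cast; rfl
  rw [e1, e2, ← Real.rpow_add (by norm_num)]
  refine Real.rpow_le_rpow_of_exponent_le (by norm_num) ?_
  have h2 := hsq n
  have h3 : α * (n.size : ℝ) ^ 2 ≤ (n.size : ℝ) ^ 2 :=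
    mul_le_of_le_one_left (by positivity) h1.le
  linarith

/-- The Cantor function is Hölder continuous with every exponent `α < 1`. -/
lemma exists_cantorRel_holder {α : ℝ} (h0 : 0 < α) (h1 : α < 1) :
    ∃ C : ℝ, 0 < C ∧ ∀ t t' s s', CantorRel t s → CantorRel t' s' →
      |s - s'| ≤ C * |t - t'| ^ α := by
  obtain ⟨C, hC, hlen⟩ := exists_half_pow_le_mul_len_rpow h0 h1
  -- compare at the first level `n` with `len n ≤ |t - t'|`
  refine ⟨4 * C, by positivity, fun t t' s s' h h' => ?_⟩
  rcases eq_or_ne t t' with rfl | hne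
  · rw [h.unique h', sub_self, abs_zero]
    positivity
  have hpos : 0 < |t - t'| := abs_pos.2 (sub_ne_zero.2 hne)
  have hex : ∃ n, len n ≤ |t - t'| := by
    obtain ⟨n, hn⟩ := exists_pow_lt_of_lt_one hpos (show (1 / 2 : ℝ) < 1 by norm_num)
    exact ⟨n, (len_le_half_pow n).trans hn.le⟩
  classical
  have hn := Nat.find_spec hex
  have hbound : |s - s'| ≤ 4 * (1 / 2) ^ Nat.find hex := by
    rcases hcase : Nat.find hex with _ | k
    · simp only [pow_zero, abs_le]
      constructor <;> linarith [h.mem_Icc.1, h.mem_Icc.2, h'.mem_Icc.1, h'.mem_Icc.2]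
    · have hlt : |t - t'| < len k := not_le.1 (Nat.find_min hex (by omega))
      refine (h.abs_sub_le h' hlt).trans (le_of_eq ?_)
      rw [pow_succ]; ring
  have h2 := hlen (Nat.find hex)
  have h3 : len (Nat.find hex) ^ α ≤ |t - t'| ^ α := Real.rpow_le_rpow (len_pos _).le hn h0.le
  have h4 := mul_le_mul_of_nonneg_left h3 hC.le
  linarith

lemma ratioCantorSet_subset_Icc : ratioCantorSet ratio ⊆ Icc (-(1 / 2)) (1 / 2) := by
  intro t ht
  obtain ⟨a, b, hab, htab⟩ := ht 0
  rwa [hab.eq_of_zero.1, hab.eq_of_zero.2] at htab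

/-- A Hölder continuous map with exponent `α < 1` sends a part of the tensor Cantor set onto a set
with interior points: apply the Cantor function to the first coordinate. -/
lemma mul_le_dimH_tensorCantorSet {d : ℕ} (hd : 1 ≤ d) {α : NNReal} (h0 : 0 < α) (h1 : α < 1) :
    (α : ℝ≥0∞) * d ≤ dimH (tensorCantorSet d ratio) := by
  classical
  have hφ : ∀ t : ℝ, ∃ s, t ∈ ratioCantorSet ratio → CantorRel t s := fun t => by
    by_cases ht : t ∈ ratioCantorSet ratio
    · obtain ⟨s, hs⟩ := exists_cantorRel_of_mem ht
      exact ⟨s, fun _ => hs⟩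
    · exact ⟨0, fun h => absurd h ht⟩
  choose φ hφ using hφ
  let i₀ : Fin d := ⟨0, hd⟩
  let Φ : EuclideanSpace ℝ (Fin d) → (Fin d → ℝ) := fun x i => if i = i₀ then φ (x i) else x i
  let S : Set (EuclideanSpace ℝ (Fin d)) :=
    {x | (∀ i, x i ∈ Icc (-(1 / 2) : ℝ) (1 / 2)) ∧ x i₀ ∈ ratioCantorSet ratio}
  obtain ⟨C, hC, hCh⟩ := exists_cantorRel_holder (α := α) (by exact_mod_cast h0)
    (by exact_mod_cast h1)
  have hholder : HolderOnWith (max 1 C).toNNReal α Φ S := by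
    intro x hx y hy
    rw [edist_pi_le_iff]
    intro i
    have hxy : |x i - y i| ≤ dist x y := by
      rw [← Real.norm_eq_abs, dist_eq_norm]
      exact PiLp.norm_apply_le (x - y) i
    have hpow : |x i - y i| ^ (α : ℝ) ≤ dist x y ^ (α : ℝ) :=
      Real.rpow_le_rpow (abs_nonneg _) hxy α.coe_nonneg
    have hreal : dist (Φ x i) (Φ y i) ≤ max 1 C * dist x y ^ (α : ℝ) := by
      have hD : 0 ≤ dist x y ^ (α : ℝ) := by positivity
      rw [Real.dist_eq]
      by_cases hi : i = i₀
      · subst hi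
        simp only [Φ, if_true]
        refine (hCh _ _ _ _ (hφ _ hx.2) (hφ _ hy.2)).trans ?_
        exact mul_le_mul (le_max_right _ _) hpow (by positivity) (by positivity)
      · simp only [Φ, hi, if_false]
        have hle : |x i - y i| ≤ 1 := by
          have h2 := hx.1 i
          have h3 := hy.1 i
          rw [abs_le]
          constructor <;> linarith [h2.1, h2.2, h3.1, h3.2]
        have h4 : |x i - y i| ≤ |x i - y i| ^ (α : ℝ) :=
          Real.self_le_rpow_of_le_one (abs_nonneg _) hle (by exact_mod_cast h1.le)
        have h5 := mul_le_mul_of_nonneg_right (le_max_left 1 C) hD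
        linarith
    rw [edist_dist, edist_dist, ENNReal.ofReal_rpow_of_nonneg dist_nonneg α.coe_nonneg]
    change _ ≤ ENNReal.ofReal _ * _
    rw [← ENNReal.ofReal_mul (by positivity)]
    exact ENNReal.ofReal_le_ofReal hreal
  have hsub : univ.pi (fun i => if i = i₀ then Ioo (0 : ℝ) 1 else Ioo (-(1 / 2) : ℝ) (1 / 2))
      ⊆ Φ '' S := by
    intro y hy
    have hy0 : y i₀ ∈ Ioo (0 : ℝ) 1 := by simpa using hy i₀ trivial
    have hyi : ∀ i ≠ i₀, y i ∈ Ioo (-(1 / 2) : ℝ) (1 / 2) := fun i hi => by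
      simpa [hi] using hy i trivial
    obtain ⟨t, ht, hts⟩ := exists_cantorRel_of_mem_Ico ⟨hy0.1.le, hy0.2⟩
    refine ⟨WithLp.toLp 2 (Function.update y i₀ t), ⟨fun i => ?_, by simpa using ht⟩, ?_⟩
    · by_cases hi : i = i₀
      · subst hi
        simpa using ratioCantorSet_subset_Icc ht
      · simpa [hi] using Ioo_subset_Icc_self (hyi i hi)
    · ext i
      by_cases hi : i = i₀
      · subst hi
        simpa [Φ] using (hφ t ht).unique hts
      · simp [Φ, hi]
  have hopen : IsOpen
      (univ.pi (fun i => if i = i₀ then Ioo (0 : ℝ) 1 else Ioo (-(1 / 2) : ℝ) (1 / 2))) := by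
    refine isOpen_set_pi finite_univ fun i _ => ?_
    split_ifs <;> exact isOpen_Ioo
  have hne : (univ.pi
      (fun i => if i = i₀ then Ioo (0 : ℝ) 1 else Ioo (-(1 / 2) : ℝ) (1 / 2))).Nonempty := by
    refine univ_pi_nonempty_iff.2 fun i => ?_
    split_ifs
    · exact ⟨1 / 2, by norm_num⟩
    · exact ⟨0, by norm_num⟩
  have hdim : dimH (Φ '' S) = d := by
    rw [Real.dimH_of_nonempty_interior (hne.mono (interior_maximal hsub hopen))]
    simp
  have hSE : S ⊆ tensorCantorSet d ratio := fun x hx => ⟨hx.1, i₀, hx.2⟩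
  have h2 := hholder.dimH_image_le h0
  rw [hdim, ENNReal.le_div_iff_mul_le (Or.inl (by exact_mod_cast h0.ne'))
    (Or.inl ENNReal.coe_ne_top), mul_comm] at h2
  exact h2.trans (dimH_mono hSE)

lemma dimH_tensorCantorSet {d : ℕ} (hd : 1 ≤ d) : dimH (tensorCantorSet d ratio) = d := by
  have hle : dimH (tensorCantorSet d ratio) ≤ d := by
    refine (dimH_mono (subset_univ _)).trans ?_
    rw [Real.dimH_univ_eq_finrank]
    simp
  refine le_antisymm hle ?_
  have hlim : Tendsto (fun n : ℕ => ((1 - 1 / ((n : NNReal) + 2) : NNReal) : ℝ≥0∞) * d) atTop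
      (𝓝 (((1 - 0 : NNReal) : ℝ≥0∞) * d)) := by
    refine ENNReal.Tendsto.mul_const (ENNReal.tendsto_coe.2 ?_) (Or.inr (by simp))
    refine tendsto_const_nhds.sub ?_
    have := (tendsto_one_div_add_atTop_nhds_zero_nat (𝕜 := NNReal)).comp (tendsto_add_atTop_nat 1)
    refine this.congr fun n => ?_
    simp only [Function.comp, Nat.cast_add, Nat.cast_one, add_assoc, one_add_one_eq_two]
  rw [tsub_zero, ENNReal.coe_one, one_mul] at hlim
  refine le_of_tendsto' hlim fun n => mul_le_dimH_tensorCantorSet hd ?_ ?_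
  · rw [tsub_pos_iff_lt, div_lt_one (by positivity)]
    exact lt_of_lt_of_le one_lt_two (le_add_of_nonneg_left zero_le)
  · exact tsub_lt_self one_pos (by positivity)

/-! ### Riesz products as Fourier transforms -/

section RieszProducts

open scoped SchwartzMap

variable {d : ℕ}

/-- The Schwartz function `ξ ↦ f ξ / 2 + (f (ξ - a) + f (ξ + a)) / 4`. On the Fourier side this
is multiplication by `(1 + cos (2 π ⟨a, x⟩)) / 2`. -/
noncomputable def rieszStep {V : Type*} [NormedAddCommGroup V] [NormedSpace ℝ V] (a : V)
    (f : 𝓢(V, ℂ)) : 𝓢(V, ℂ) :=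
  (1 / 2 : ℂ) • f + (1 / 4 : ℂ) • (f.compSubConstCLM ℂ a + f.compSubConstCLM ℂ (-a))

lemma rieszStep_apply {V : Type*} [NormedAddCommGroup V] [NormedSpace ℝ V] (a : V)
    (f : 𝓢(V, ℂ)) (ξ : V) :
    rieszStep a f ξ = 1 / 2 * f ξ + 1 / 4 * (f (ξ - a) + f (ξ + a)) := by
  simp [rieszStep, mul_add]

lemma fourier_compSubConst {V : Type*} [NormedAddCommGroup V] [InnerProductSpace ℝ V]
    [FiniteDimensional ℝ V] [MeasurableSpace V] [BorelSpace V] (a : V) (f : 𝓢(V, ℂ)) (x : V) :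
    𝓕 (f.compSubConstCLM ℂ a) x
      = Complex.exp (↑(-(2 * Real.pi * inner ℝ a x)) * Complex.I) * 𝓕 f x := by
  have h := congrFun (VectorFourier.fourierIntegral_comp_add_right Real.fourierChar
    (volume : Measure V) (innerₗ V) f (-a)) x
  simp only [SchwartzMap.fourier_coe]
  have e : (f.compSubConstCLM ℂ a : V → ℂ) = f ∘ fun v => v + -a := by
    ext v; simp [sub_eq_add_neg]
  rw [e]
  refine h.trans ?_
  rw [Circle.smul_def, Real.fourierChar_apply, smul_eq_mul]
  congr 2
  simp

lemma fourier_rieszStep {V : Type*} [NormedAddCommGroup V] [InnerProductSpace ℝ V]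
    [FiniteDimensional ℝ V] [MeasurableSpace V] [BorelSpace V] (a : V) (f : 𝓢(V, ℂ)) (x : V) :
    𝓕 (rieszStep a f) x = (((1 + Real.cos (2 * Real.pi * inner ℝ a x)) / 2 : ℝ) : ℂ) * 𝓕 f x := by
  have h1 := fourier_compSubConst a f x
  have h2 := fourier_compSubConst (-a) f x
  have e : 𝓕 (rieszStep a f) = (1 / 2 : ℂ) • 𝓕 f + (1 / 4 : ℂ) •
      (𝓕 (f.compSubConstCLM ℂ a) + 𝓕 (f.compSubConstCLM ℂ (-a))) := by
    simp only [rieszStep, FourierTransform.fourier_add, FourierTransform.fourier_smul]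
  rw [e]
  simp only [_root_.add_apply, _root_.smul_apply, smul_eq_mul, h1, h2]
  have hc := Complex.two_cos (((2 * Real.pi * inner ℝ a x : ℝ) : ℂ))
  rw [inner_neg_left]
  push_cast at hc ⊢
  rw [show -(2 * (Real.pi : ℂ) * -((inner ℝ a x : ℝ) : ℂ)) * Complex.I
    = (2 * (Real.pi : ℂ) * ((inner ℝ a x : ℝ) : ℂ)) * Complex.I by ring]
  linear_combination (-(1 / 4 : ℂ)) * 𝓕 f x * hc

/-- The function whose Fourier transform is the Riesz product
`∏ j < k, (1 + cos (2 π freq j x_i)) / 2` times the Fourier transform of `g`. -/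
noncomputable def rieszPiece (g : 𝓢(EuclideanSpace ℝ (Fin d), ℂ)) (i : Fin d) :
    ℕ → 𝓢(EuclideanSpace ℝ (Fin d), ℂ)
  | 0 => g
  | k + 1 => rieszStep (EuclideanSpace.single i (freq k : ℝ)) (rieszPiece g i k)

/-- The Riesz product with frequencies `freq 0, …, freq (k - 1)`. -/
noncomputable def rieszProd (k : ℕ) (t : ℝ) : ℝ :=
  ∏ j ∈ Finset.range k, (1 + Real.cos (2 * Real.pi * (freq j * t))) / 2

lemma rieszProd_nonneg (k : ℕ) (t : ℝ) : 0 ≤ rieszProd k t :=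
  Finset.prod_nonneg fun j _ => by
    linarith [Real.neg_one_le_cos (2 * Real.pi * (freq j * t))]

lemma continuous_rieszProd (k : ℕ) : Continuous (rieszProd k) := by
  unfold rieszProd
  fun_prop

lemma fourier_rieszPiece (g : 𝓢(EuclideanSpace ℝ (Fin d), ℂ)) (i : Fin d) (k : ℕ)
    (x : EuclideanSpace ℝ (Fin d)) :
    𝓕 (rieszPiece g i k) x = (rieszProd k (x i) : ℂ) * 𝓕 g x := by
  induction k with
  | zero => simp [rieszPiece, rieszProd]
  | succ k ih =>
    rw [rieszPiece, fourier_rieszStep, ih, EuclideanSpace.inner_single_left, rieszProd, rieszProd,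
      Finset.prod_range_succ]
    simp only [conj_trivial]
    push_cast
    ring

/-- The Riesz products stay bounded below on the Cantor set, as the frequencies resonate with
it. -/
lemma third_le_rieszProd {t : ℝ} (ht : t ∈ ratioCantorSet ratio) (k : ℕ) :
    1 / 3 ≤ rieszProd k t := by
  have hfac : ∀ j : ℕ, 1 - 10 * (1 / 16) ^ (j + 1) ≤
      (1 + Real.cos (2 * Real.pi * (freq j * t))) / 2 := by
    intro j
    obtain ⟨n, hn⟩ := exists_int_abs_freq_mul_sub_le ht j
    have hcos : Real.cos (2 * Real.pi * (freq j * t))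
        = Real.cos (2 * Real.pi * (freq j * t - n)) := by
      rw [mul_sub, mul_comm _ (n : ℝ), Real.cos_sub_int_mul_two_pi]
    rw [hcos]
    set u := freq j * t - n
    have h1 := Real.one_sub_sq_div_two_le_cos (x := 2 * Real.pi * u)
    have h2 : u ^ 2 ≤ (1 / 16) ^ (j + 1) := by
      rw [← sq_abs]
      refine (pow_le_pow_left₀ (abs_nonneg _) hn 2).trans (le_of_eq ?_)
      rw [← pow_mul, mul_comm, pow_mul]; norm_num
    have h3 : Real.pi ^ 2 ≤ 10 := by nlinarith [Real.pi_lt_d2, Real.pi_pos]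
    have h4 := mul_le_mul h3 h2 (sq_nonneg u) (by norm_num)
    nlinarith
  -- `2 / 3 = ∑ j, 10 / 16 ^ (j + 1)`; the second summand is the part
  -- of this sum that belongs to the factors with `j ≥ k`
  have key : ∀ k : ℕ, 1 / 3 + 2 / 3 * (1 / 16) ^ k ≤ rieszProd k t := by
    intro k
    induction k with
    | zero => norm_num [rieszProd]
    | succ k ih =>
      have hle : rieszProd k t ≤ 1 := Finset.prod_le_one
        (fun j _ => by linarith [Real.neg_one_le_cos (2 * Real.pi * (freq j * t))])
        (fun j _ => by linarith [Real.cos_le_one (2 * Real.pi * (freq j * t))])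
      have h0 := rieszProd_nonneg k t
      have e : rieszProd (k + 1) t
          = rieszProd k t * ((1 + Real.cos (2 * Real.pi * (freq k * t))) / 2) := by
        simp only [rieszProd, Finset.prod_range_succ]
      have h1 := mul_le_mul_of_nonneg_left (hfac k) h0
      have h2 : (0 : ℝ) < (1 / 16) ^ (k + 1) := by positivity
      have h3 := mul_le_mul_of_nonneg_right hle h2.le
      have h4 : (1 / 16 : ℝ) ^ k = 16 * (1 / 16) ^ (k + 1) := by rw [pow_succ]; ring
      rw [e]
      linarith
  have := key k
  have : (0 : ℝ) < (1 / 16) ^ k := by positivity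
  linarith

lemma abs_apply_lt_of_rieszPiece_ne_zero {g : 𝓢(EuclideanSpace ℝ (Fin d), ℂ)} {i : Fin d}
    (hg : ∀ ξ, g ξ ≠ 0 → |ξ i| < 1) (k : ℕ) {ξ : EuclideanSpace ℝ (Fin d)}
    (h : rieszPiece g i k ξ ≠ 0) : 2 * |ξ i| < freq k := by
  induction k generalizing ξ with
  | zero =>
    have h1 := hg ξ h
    have h2 : (8 : ℝ) ≤ freq 0 := by exact_mod_cast eight_le_freq 0
    linarith
  | succ k ih =>
    have hN : 4 * (freq k : ℝ) ≤ freq (k + 1) := by exact_mod_cast four_mul_freq_le k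
    have h0 : (8 : ℝ) ≤ freq k := by exact_mod_cast eight_le_freq k
    rw [rieszPiece, rieszStep_apply] at h
    by_cases h1 : rieszPiece g i k ξ = 0
    · by_cases h2 : rieszPiece g i k (ξ - EuclideanSpace.single i (freq k : ℝ)) = 0
      · by_cases h3 : rieszPiece g i k (ξ + EuclideanSpace.single i (freq k : ℝ)) = 0
        · simp [h1, h2, h3] at h
        · have := ih h3
          simp only [PiLp.add_apply, PiLp.single_apply, if_true] at this
          have := abs_sub_abs_le_abs_sub (ξ i) (-(freq k : ℝ))
          rw [sub_neg_eq_add, abs_neg, abs_of_nonneg (show (0 : ℝ) ≤ freq k by linarith)] at this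
          linarith
      · have := ih h2
        simp only [PiLp.sub_apply, PiLp.single_apply, if_true] at this
        have := abs_sub_abs_le_abs_sub (ξ i) (freq k : ℝ)
        rw [abs_of_nonneg (show (0 : ℝ) ≤ freq k by linarith)] at this
        linarith
    · have := ih h1
      linarith

/-- The three translates in `rieszStep` have disjoint supports, so the supremum is halved. -/
lemma norm_rieszPiece_le {g : 𝓢(EuclideanSpace ℝ (Fin d), ℂ)} {i : Fin d}
    (hg : ∀ ξ, g ξ ≠ 0 → |ξ i| < 1) (hg1 : ∀ ξ, ‖g ξ‖ ≤ 1) (k : ℕ)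
    (ξ : EuclideanSpace ℝ (Fin d)) : ‖rieszPiece g i k ξ‖ ≤ (1 / 2) ^ k := by
  induction k generalizing ξ with
  | zero => simpa [rieszPiece] using hg1 ξ
  | succ k ih =>
    set a := EuclideanSpace.single i (freq k : ℝ) with ha
    have hai : a i = freq k := by simp [ha]
    have hN : (8 : ℝ) ≤ freq k := by exact_mod_cast eight_le_freq k
    have s1 := @abs_apply_lt_of_rieszPiece_ne_zero d g i hg k ξ
    have s2 := @abs_apply_lt_of_rieszPiece_ne_zero d g i hg k (ξ - a)
    have s3 := @abs_apply_lt_of_rieszPiece_ne_zero d g i hg k (ξ + a)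
    rw [PiLp.sub_apply, hai] at s2
    rw [PiLp.add_apply, hai] at s3
    have n1 := ih ξ
    have n2 := ih (ξ - a)
    have n3 := ih (ξ + a)
    rw [rieszPiece, rieszStep_apply, pow_succ]
    generalize rieszPiece g i k ξ = z1 at *
    generalize rieszPiece g i k (ξ - a) = z2 at *
    generalize rieszPiece g i k (ξ + a) = z3 at *
    have hp : (0 : ℝ) < (1 / 2) ^ k := by positivity
    generalize (1 / 2 : ℝ) ^ k = q at *
    by_cases h1 : z1 = 0
    · by_cases h2 : z2 = 0
      · simp only [h1, h2, mul_zero, zero_add, norm_mul]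
        norm_num
        linarith
      · have h3 : z3 = 0 := by
          by_contra h3
          have := s2 h2
          have := s3 h3
          linarith [neg_abs_le (ξ i - freq k), le_abs_self (ξ i + freq k)]
        simp only [h1, h3, mul_zero, zero_add, add_zero, norm_mul]
        norm_num
        linarith
    · have t1 := s1 h1
      have h2 : z2 = 0 := by
        by_contra h2
        have t2 := s2 h2
        linarith [neg_abs_le (ξ i - freq k), le_abs_self (ξ i)]
      have h3 : z3 = 0 := by
        by_contra h3
        have t3 := s3 h3
        linarith [le_abs_self (ξ i + freq k), neg_abs_le (ξ i)]
      simp only [h2, h3, mul_zero, add_zero, norm_mul]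
      norm_num
      linarith

lemma lintegral_enorm_rieszPiece_le (g : 𝓢(EuclideanSpace ℝ (Fin d), ℂ)) (i : Fin d) (k : ℕ) :
    ∫⁻ ξ, ‖rieszPiece g i k ξ‖ₑ ≤ ∫⁻ ξ, ‖g ξ‖ₑ := by
  induction k with
  | zero => rfl
  | succ k ih =>
    set a := EuclideanSpace.single i (freq k : ℝ)
    set f := rieszPiece g i k with hf
    have hm : Measurable fun ξ => ‖f ξ‖ₑ := f.continuous.measurable.enorm
    have hm1 : Measurable fun ξ => ‖f (ξ - a)‖ₑ := hm.comp (measurable_sub_const a)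
    have hm2 : Measurable fun ξ => ‖f (ξ + a)‖ₑ := hm.comp (measurable_add_const a)
    have hm12 : Measurable fun ξ => ‖f (ξ - a)‖ₑ + ‖f (ξ + a)‖ₑ := hm1.add hm2
    have hle : ∀ ξ, ‖rieszPiece g i (k + 1) ξ‖ₑ ≤
        2⁻¹ * ‖f ξ‖ₑ + 4⁻¹ * (‖f (ξ - a)‖ₑ + ‖f (ξ + a)‖ₑ) := by
      intro ξ
      rw [rieszPiece, rieszStep_apply]
      have c2 : ‖(1 / 2 : ℂ)‖ₑ = 2⁻¹ := by
        rw [one_div, enorm_inv (by norm_num)]; norm_num [enorm]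
      have c4 : ‖(1 / 4 : ℂ)‖ₑ = 4⁻¹ := by
        rw [one_div, enorm_inv (by norm_num)]; norm_num [enorm]
      refine (enorm_add_le _ _).trans ?_
      rw [enorm_mul, enorm_mul, c2, c4]
      gcongr
      exact enorm_add_le _ _
    calc ∫⁻ ξ, ‖rieszPiece g i (k + 1) ξ‖ₑ
        ≤ ∫⁻ ξ, (2⁻¹ * ‖f ξ‖ₑ + 4⁻¹ * (‖f (ξ - a)‖ₑ + ‖f (ξ + a)‖ₑ)) := lintegral_mono hle
      _ = 2⁻¹ * (∫⁻ ξ, ‖f ξ‖ₑ) + 4⁻¹ * ((∫⁻ ξ, ‖f ξ‖ₑ) + ∫⁻ ξ, ‖f ξ‖ₑ) := by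
          rw [lintegral_add_left (hm.const_mul _), lintegral_const_mul _ hm,
            lintegral_const_mul _ hm12, lintegral_add_left hm1,
            lintegral_sub_right_eq_self (fun ξ => ‖f ξ‖ₑ) a,
            lintegral_add_right_eq_self (fun ξ => ‖f ξ‖ₑ) a]
      _ = ∫⁻ ξ, ‖f ξ‖ₑ := by
          rw [← two_mul, ← mul_assoc, ← add_mul]
          have : (2⁻¹ + 4⁻¹ * 2 : ℝ≥0∞) = 1 := by
            rw [show (4 : ℝ≥0∞) = 2 * 2 by norm_num, ENNReal.mul_inv (by simp) (by simp), mul_assoc,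
              ENNReal.inv_mul_cancel (by simp) (by simp), mul_one, ENNReal.inv_two_add_inv_two]
          rw [this, one_mul]
      _ ≤ _ := ih

/-! ### The window and the `L^p` bounds -/

/-- A smooth function supported near the origin, whose Fourier transform has positive real part on
a large ball. -/
lemma exists_window (d : ℕ) : ∃ g : 𝓢(EuclideanSpace ℝ (Fin d), ℂ),
    (∀ ξ, g ξ ≠ 0 → ‖ξ‖ < 1) ∧ (∀ ξ, ‖g ξ‖ ≤ 1) ∧
    ∀ x : EuclideanSpace ℝ (Fin d), ‖x‖ < d + 1 → 0 < (𝓕 g x).re := by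
  set ρ : ℝ := 1 / (8 * (d + 1)) with hρ
  have hρ0 : 0 < ρ := by positivity
  have hρ1 : ρ < 1 := by
    rw [hρ, div_lt_one (by positivity)]
    have : (0 : ℝ) ≤ d := by positivity
    linarith
  let b : ContDiffBump (0 : EuclideanSpace ℝ (Fin d)) := ⟨ρ / 2, ρ, by positivity, by linarith⟩
  have hsupp : ∀ ξ, b ξ ≠ 0 → ‖ξ‖ < ρ := fun ξ h => by
    have : ξ ∈ Function.support b := h
    rw [b.support_eq] at this
    simpa using this
  have hcs : HasCompactSupport fun ξ => (b ξ : ℂ) := b.hasCompactSupport.comp_left Complex.ofReal_zero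
  have hcd : ContDiff ℝ (⊤ : ℕ∞) fun ξ => (b ξ : ℂ) := Complex.ofRealCLM.contDiff.comp b.contDiff
  refine ⟨hcs.toSchwartzMap hcd, fun ξ h => ?_, fun ξ => ?_, fun x hx => ?_⟩
  · have : b ξ ≠ 0 := by simpa using h
    exact (hsupp ξ this).trans hρ1
  · change ‖(b ξ : ℂ)‖ ≤ 1
    rw [Complex.norm_real, Real.norm_of_nonneg b.nonneg]
    exact b.le_one
  · have hre : (𝓕 (hcs.toSchwartzMap hcd) x).re
        = ∫ ξ, Real.cos (2 * Real.pi * inner ℝ ξ x) * b ξ := by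
      rw [SchwartzMap.fourier_coe, Real.fourier_eq', ← RCLike.re_eq_complex_re, ← integral_re]
      · refine integral_congr_ae (Eventually.of_forall fun ξ => ?_)
        change (Complex.exp _ • (b ξ : ℂ)).re = _
        rw [smul_eq_mul, Complex.re_mul_ofReal, Complex.exp_ofReal_mul_I_re]
        congr 1
        rw [← Real.cos_neg]
        congr 1
        ring
      · have := (Real.fourierIntegral_convergent_iff (μ := volume) (f := hcs.toSchwartzMap hcd) x).2
          (hcs.toSchwartzMap hcd).integrable
        refine this.congr (Eventually.of_forall fun ξ => ?_)
        simp only [Circle.smul_def, Real.fourierChar_apply, smul_eq_mul]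
        congr 2
        simp
    have hlow : ∀ ξ, 1 / 2 * b ξ ≤ Real.cos (2 * Real.pi * inner ℝ ξ x) * b ξ := by
      intro ξ
      by_cases h0 : b ξ = 0
      · simp [h0]
      refine mul_le_mul_of_nonneg_right ?_ b.nonneg
      have h1 : |inner ℝ ξ x| ≤ 1 / 8 := by
        refine (abs_real_inner_le_norm ξ x).trans ?_
        calc ‖ξ‖ * ‖x‖ ≤ ρ * (d + 1) :=
              mul_le_mul (hsupp ξ h0).le hx.le (norm_nonneg _) hρ0.le
          _ = 1 / 8 := by rw [hρ]; field_simp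
      have h2 := Real.one_sub_sq_div_two_le_cos (x := 2 * Real.pi * inner ℝ ξ x)
      have h3 : (inner ℝ ξ x) ^ 2 ≤ (1 / 8 : ℝ) ^ 2 := sq_le_sq' (abs_le.1 h1).1 (abs_le.1 h1).2
      have h4 : Real.pi ^ 2 ≤ 10 := by nlinarith [Real.pi_lt_d2, Real.pi_pos]
      have h5 := mul_le_mul h4 h3 (sq_nonneg _) (by norm_num)
      nlinarith
    have hint : Integrable (fun ξ => Real.cos (2 * Real.pi * inner ℝ ξ x) * b ξ) := by
      refine Continuous.integrable_of_hasCompactSupport ?_ b.hasCompactSupport.mul_left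
      have := b.continuous
      fun_prop
    have hbint : Integrable (fun ξ => 1 / 2 * b ξ) := b.integrable.const_mul _
    rw [hre]
    refine lt_of_lt_of_le ?_ (integral_mono hbint hint hlow)
    rw [integral_const_mul]
    have := b.integral_pos (μ := volume)
    positivity

/-- Geometrically decaying suprema and bounded `L¹` norms give, by interpolation, summable `L^p`
norms for every `p > 1`. -/
lemma tsum_eLpNorm_ne_top {α E : Type*} [MeasurableSpace α] {μ : Measure α} [NormedAddCommGroup E]
    {u : ℕ → α → E} {D A : ℝ≥0∞} (hD : D ≠ ∞) (hA : A ≠ ∞)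
    (hsup : ∀ k x, ‖u k x‖ₑ ≤ D * 2⁻¹ ^ k) (hint : ∀ k, ∫⁻ x, ‖u k x‖ₑ ∂μ ≤ A)
    {p : ℝ≥0∞} (hp : 1 < p) : ∑' k, eLpNorm (u k) p μ ≠ ∞ := by
  have hgeom : ∀ (c r : ℝ≥0∞), c ≠ ∞ → r < 1 → (∀ k, eLpNorm (u k) p μ ≤ c * r ^ k) →
      ∑' k, eLpNorm (u k) p μ ≠ ∞ := by
    intro c r hc hr hle
    refine ne_top_of_le_ne_top ?_ (ENNReal.tsum_le_tsum hle)
    rw [ENNReal.tsum_mul_left, ENNReal.tsum_geometric]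
    exact ENNReal.mul_ne_top hc (ENNReal.inv_ne_top.2 (tsub_pos_of_lt hr).ne')
  rcases eq_or_ne p ∞ with rfl | hptop
  · refine hgeom D 2⁻¹ hD (ENNReal.inv_lt_one.2 ENNReal.one_lt_two) fun k => ?_
    rw [eLpNorm_exponent_top]
    exact eLpNormEssSup_le_of_ae_enorm_bound (Eventually.of_forall (hsup k))
  · set q := p.toReal with hq
    have hq1 : 1 < q := by
      rw [hq, ← ENNReal.toReal_one]
      exact (ENNReal.toReal_lt_toReal ENNReal.one_ne_top hptop).2 hp
    have hq0 : 0 < q := by linarith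
    have hr : (2⁻¹ : ℝ≥0∞) ^ ((q - 1) / q) < 1 :=
      ENNReal.rpow_lt_one (ENNReal.inv_lt_one.2 ENNReal.one_lt_two) (div_pos (by linarith) hq0)
    refine hgeom (D ^ ((q - 1) / q) * A ^ (1 / q)) _ (ENNReal.mul_ne_top
      (ENNReal.rpow_ne_top_of_nonneg (div_nonneg (by linarith) hq0.le) hD)
      (ENNReal.rpow_ne_top_of_nonneg (by positivity) hA)) hr fun k => ?_
    rw [eLpNorm_eq_lintegral_rpow_enorm_toReal (by positivity) hptop, ← hq]
    have hle : ∫⁻ x, ‖u k x‖ₑ ^ q ∂μ ≤ (D * 2⁻¹ ^ k) ^ (q - 1) * A := by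
      have hfin : (D * 2⁻¹ ^ k) ^ (q - 1) ≠ ∞ := ENNReal.rpow_ne_top_of_nonneg (by linarith)
        (ENNReal.mul_ne_top hD (ENNReal.pow_ne_top (by simp)))
      calc ∫⁻ x, ‖u k x‖ₑ ^ q ∂μ ≤ ∫⁻ x, (D * 2⁻¹ ^ k) ^ (q - 1) * ‖u k x‖ₑ ∂μ := by
            refine lintegral_mono fun x => ?_
            have e : ‖u k x‖ₑ ^ q = ‖u k x‖ₑ ^ (q - 1) * ‖u k x‖ₑ := by
              conv_rhs => rw [← ENNReal.rpow_one ‖u k x‖ₑ, ← ENNReal.rpow_mul, one_mul]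
              rw [← ENNReal.rpow_add_of_nonneg _ _ (by linarith) zero_le_one, sub_add_cancel]
            simp only [e]
            gcongr
            exact hsup k x
        _ = (D * 2⁻¹ ^ k) ^ (q - 1) * ∫⁻ x, ‖u k x‖ₑ ∂μ := lintegral_const_mul' _ _ hfin
        _ ≤ _ := by gcongr; exact hint k
    calc (∫⁻ x, ‖u k x‖ₑ ^ q ∂μ) ^ (1 / q) ≤ ((D * 2⁻¹ ^ k) ^ (q - 1) * A) ^ (1 / q) := by
          gcongr
      _ = _ := by
          rw [ENNReal.mul_rpow_of_nonneg _ _ (by positivity), ← ENNReal.rpow_mul, mul_one_div,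
            ENNReal.mul_rpow_of_nonneg _ _ (div_nonneg (by linarith) hq0.le),
            ← ENNReal.rpow_natCast, ← ENNReal.rpow_natCast, ← ENNReal.rpow_mul, ← ENNReal.rpow_mul,
            mul_comm (k : ℝ)]
          ring

/-! ### The counterexample -/

/-- The sum over all coordinate directions of the functions `rieszPiece g i k`. -/
noncomputable def rieszLayer (g : 𝓢(EuclideanSpace ℝ (Fin d), ℂ)) (k : ℕ) :
    𝓢(EuclideanSpace ℝ (Fin d), ℂ) :=
  ∑ i, rieszPiece g i k

lemma rieszLayer_apply (g : 𝓢(EuclideanSpace ℝ (Fin d), ℂ)) (k : ℕ)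
    (ξ : EuclideanSpace ℝ (Fin d)) : rieszLayer g k ξ = ∑ i, rieszPiece g i k ξ := by
  simp [rieszLayer]

lemma fourier_rieszLayer (g : 𝓢(EuclideanSpace ℝ (Fin d), ℂ)) (k : ℕ)
    (x : EuclideanSpace ℝ (Fin d)) :
    𝓕 (rieszLayer g k) x = ((∑ i, rieszProd k (x i) : ℝ) : ℂ) * 𝓕 g x := by
  have : 𝓕 (rieszLayer g k) = ∑ i, 𝓕 (rieszPiece g i k) :=
    map_sum (FourierTransform.fourierCLM ℂ 𝓢(EuclideanSpace ℝ (Fin d), ℂ)) _ _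
  rw [this]
  simp only [_root_.sum_apply, fourier_rieszPiece]
  push_cast
  rw [Finset.sum_mul]

lemma tsum_eLpNorm_rieszLayer_ne_top {g : 𝓢(EuclideanSpace ℝ (Fin d), ℂ)}
    (hg : ∀ ξ, g ξ ≠ 0 → ‖ξ‖ < 1) (hg1 : ∀ ξ, ‖g ξ‖ ≤ 1) {p : ℝ≥0∞} (hp : 1 < p) :
    ∑' k, eLpNorm (rieszLayer g k) p volume ≠ ∞ := by
  have hA : ∫⁻ ξ, ‖g ξ‖ₑ ≠ ∞ := g.integrable.hasFiniteIntegral.ne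
  refine tsum_eLpNorm_ne_top (D := d) (A := d * ∫⁻ ξ, ‖g ξ‖ₑ) (by simp)
    (ENNReal.mul_ne_top (by simp) hA) (fun k ξ => ?_) (fun k => ?_) hp
  · rw [rieszLayer_apply]
    refine (enorm_sum_le _ _).trans ?_
    have : ∀ i : Fin d, ‖rieszPiece g i k ξ‖ₑ ≤ 2⁻¹ ^ k := by
      intro i
      have h := norm_rieszPiece_le (i := i)
        (fun ξ h => lt_of_le_of_lt (by simpa using PiLp.norm_apply_le ξ i) (hg ξ h)) hg1 k ξ
      rw [← ofReal_norm]
      refine (ENNReal.ofReal_le_ofReal h).trans (le_of_eq ?_)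
      rw [ENNReal.ofReal_pow (by norm_num), one_div, ENNReal.ofReal_inv_of_pos two_pos]
      simp
    refine (Finset.sum_le_sum fun i _ => this i).trans (le_of_eq ?_)
    simp
  · calc ∫⁻ ξ, ‖rieszLayer g k ξ‖ₑ ≤ ∫⁻ ξ, ∑ i, ‖rieszPiece g i k ξ‖ₑ := by
          refine lintegral_mono fun ξ => ?_
          rw [rieszLayer_apply]
          exact enorm_sum_le _ _
      _ = ∑ i, ∫⁻ ξ, ‖rieszPiece g i k ξ‖ₑ :=
          lintegral_finsetSum _ fun i _ => (rieszPiece g i k).continuous.measurable.enorm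
      _ ≤ ∑ _i : Fin d, ∫⁻ ξ, ‖g ξ‖ₑ :=
          Finset.sum_le_sum fun i _ => lintegral_enorm_rieszPiece_le g i k
      _ = _ := by simp

/-- The function of the counterexample: the sum of all layers. -/
noncomputable def rieszSum (g : 𝓢(EuclideanSpace ℝ (Fin d), ℂ)) :
    EuclideanSpace ℝ (Fin d) → ℂ :=
  fun ξ => ∑' k, rieszLayer g k ξ

lemma coeFn_tsum_toLp_rieszLayer {g : 𝓢(EuclideanSpace ℝ (Fin d), ℂ)}
    (hg : ∀ ξ, g ξ ≠ 0 → ‖ξ‖ < 1) (hg1 : ∀ ξ, ‖g ξ‖ ≤ 1) {p : ℝ≥0∞} (hp : 1 < p)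
    [Fact (1 ≤ p)] :
    (∑' k, (rieszLayer g k).toLp p : Lp ℂ p (volume : Measure (EuclideanSpace ℝ (Fin d))))
      =ᵐ[volume] rieszSum g := by
  have h1 := Lp.coeFn_tsum (f := fun k => (rieszLayer g k).toLp p) (by
    simpa only [SchwartzMap.toLp, Lp.enorm_toLp] using tsum_eLpNorm_rieszLayer_ne_top hg hg1 hp)
  have h2 : ∀ᵐ ξ, ∀ k, (rieszLayer g k).toLp p volume ξ = rieszLayer g k ξ :=
    ae_all_iff.2 fun k => (rieszLayer g k).coeFn_toLp p volume
  filter_upwards [h1, h2] with ξ e1 e2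
  rw [e1, rieszSum]
  exact tsum_congr e2

lemma memLp_rieszSum {g : 𝓢(EuclideanSpace ℝ (Fin d), ℂ)}
    (hg : ∀ ξ, g ξ ≠ 0 → ‖ξ‖ < 1) (hg1 : ∀ ξ, ‖g ξ‖ ≤ 1) {p : ℝ≥0∞} (hp : 1 < p) :
    MemLp (rieszSum g) p volume :=
  haveI : Fact (1 ≤ p) := ⟨hp.le⟩
  (Lp.memLp _).ae_eq (coeFn_tsum_toLp_rieszLayer hg hg1 hp)

/-- The series of the Fourier transforms converges almost everywhere. -/
lemma ae_hasSum_fourier_rieszLayer {g : 𝓢(EuclideanSpace ℝ (Fin d), ℂ)}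
    (hg : ∀ ξ, g ξ ≠ 0 → ‖ξ‖ < 1) (hg1 : ∀ ξ, ‖g ξ‖ ≤ 1) (hf : MemLp (rieszSum g) 2 volume) :
    ∀ᵐ x, HasSum (fun k => 𝓕 (rieszLayer g k) x)
      ((𝓕 (hf.toLp (rieszSum g)) : Lp ℂ 2 (volume : Measure (EuclideanSpace ℝ (Fin d)))) x) := by
  have hfin : ∑' k, ‖(rieszLayer g k).toLp 2 (volume : Measure (EuclideanSpace ℝ (Fin d)))‖ₑ ≠ ∞ := by
    simpa only [SchwartzMap.toLp, Lp.enorm_toLp] using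
      tsum_eLpNorm_rieszLayer_ne_top hg hg1 ENNReal.one_lt_two
  have heq : hf.toLp (rieszSum g) = ∑' k, (rieszLayer g k).toLp 2 := by
    refine Lp.ext (hf.coeFn_toLp.trans ?_)
    exact (coeFn_tsum_toLp_rieszLayer hg hg1 ENNReal.one_lt_two).symm
  have hF : 𝓕 (hf.toLp (rieszSum g)) = ∑' k, 𝓕 ((rieszLayer g k).toLp 2
      (volume : Measure (EuclideanSpace ℝ (Fin d)))) := by
    rw [heq]
    exact (Lp.fourierTransformₗᵢ (EuclideanSpace ℝ (Fin d)) ℂ).toContinuousLinearEquiv.map_tsum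
  have hfinF : ∑' k, ‖𝓕 ((rieszLayer g k).toLp 2
      (volume : Measure (EuclideanSpace ℝ (Fin d))))‖ₑ ≠ ∞ := by
    have e : ∀ k, ‖𝓕 ((rieszLayer g k).toLp 2 (volume : Measure (EuclideanSpace ℝ (Fin d))))‖ₑ
        = ‖(rieszLayer g k).toLp 2 (volume : Measure (EuclideanSpace ℝ (Fin d)))‖ₑ := fun k => by
      rw [← ofReal_norm, ← ofReal_norm, Lp.norm_fourier_eq]
    simpa only [e] using hfin
  have h2 : ∀ᵐ x, ∀ k, (𝓕 ((rieszLayer g k).toLp 2 volume) : Lp ℂ 2 volume) x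
      = 𝓕 (rieszLayer g k) x := by
    refine ae_all_iff.2 fun k => ?_
    rw [SchwartzMap.toLp_fourier_eq]
    exact SchwartzMap.coeFn_toLp _ 2 volume
  rw [hF]
  filter_upwards [Lp.hasSum_coeFn_tsum hfinF, h2] with x h1 h2
  simpa only [h2] using h1

lemma norm_lt_of_mem_tensorCantorSet {θ : ℕ → ℝ} {x : EuclideanSpace ℝ (Fin d)}
    (hx : x ∈ tensorCantorSet d θ) : ‖x‖ < d + 1 := by
  have h1 : ‖x‖ ^ 2 ≤ (d : ℝ) := by
    rw [EuclideanSpace.norm_sq_eq]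
    calc ∑ i, ‖x i‖ ^ 2 ≤ ∑ _i : Fin d, (1 : ℝ) := by
          refine Finset.sum_le_sum fun i _ => ?_
          have := hx.1 i
          rw [Real.norm_eq_abs, sq_abs]
          nlinarith [this.1, this.2]
      _ = d := by simp
  have h2 : (0 : ℝ) ≤ d := by positivity
  nlinarith [norm_nonneg x]

/-- Near a point of the tensor Cantor set, the real part of the Fourier transform dominates almost
everywhere the continuous partial sums of the series, whose values at the point are unbounded. -/
lemma exists_ae_lt_re_fourier_rieszSum {g : 𝓢(EuclideanSpace ℝ (Fin d), ℂ)}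
    (hg : ∀ ξ, g ξ ≠ 0 → ‖ξ‖ < 1) (hg1 : ∀ ξ, ‖g ξ‖ ≤ 1)
    (hgF : ∀ x : EuclideanSpace ℝ (Fin d), ‖x‖ < d + 1 → 0 < (𝓕 g x).re)
    (hf : MemLp (rieszSum g) 2 volume) {x : EuclideanSpace ℝ (Fin d)}
    (hx : x ∈ tensorCantorSet d ratio) (M : ℝ) :
    ∃ δ > 0, ∀ᵐ z, z ∈ Metric.ball x δ → M <
      ((𝓕 (hf.toLp (rieszSum g)) : Lp ℂ 2 (volume : Measure (EuclideanSpace ℝ (Fin d)))) z).re := by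
  have hxn := norm_lt_of_mem_tensorCantorSet hx
  have hpos := hgF x hxn
  obtain ⟨i, hi⟩ := hx.2
  obtain ⟨K, hK⟩ := exists_nat_gt (M / ((𝓕 g x).re / 3))
  rw [div_lt_iff₀ (by positivity)] at hK
  let h : EuclideanSpace ℝ (Fin d) → ℝ :=
    fun z => ∑ k ∈ Finset.range K, (∑ i, rieszProd k (z i)) * (𝓕 g z).re
  have hcont : Continuous h := by
    refine continuous_finsetSum _ fun k _ => Continuous.mul ?_
      (Complex.continuous_re.comp (𝓕 g).continuous)
    exact continuous_finsetSum _ fun i _ => (continuous_rieszProd k).comp (by fun_prop)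
  have hhx : M < h x := by
    refine hK.trans_le ?_
    calc (K : ℝ) * ((𝓕 g x).re / 3) = ∑ _k ∈ Finset.range K, 1 / 3 * (𝓕 g x).re := by
          rw [Finset.sum_const, Finset.card_range, nsmul_eq_mul]; ring
      _ ≤ h x := by
          refine Finset.sum_le_sum fun k _ => mul_le_mul_of_nonneg_right ?_ hpos.le
          exact (third_le_rieszProd hi k).trans (Finset.single_le_sum
            (f := fun i => rieszProd k (x i)) (fun i _ => rieszProd_nonneg k _) (Finset.mem_univ i))
  have hnhds : ∀ᶠ z in 𝓝 x, M < h z ∧ ‖z‖ < d + 1 :=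
    (hcont.continuousAt.eventually (lt_mem_nhds hhx)).and
      (continuous_norm.continuousAt.eventually (gt_mem_nhds hxn))
  obtain ⟨δ, hδ, hball⟩ := Metric.eventually_nhds_iff_ball.1 hnhds
  refine ⟨δ, hδ, ?_⟩
  filter_upwards [ae_hasSum_fourier_rieszLayer hg hg1 hf] with z hz hzδ
  obtain ⟨hz1, hz2⟩ := hball z hzδ
  have hsum := Complex.hasSum_re hz
  have hterm : ∀ k, (𝓕 (rieszLayer g k) z).re = (∑ i, rieszProd k (z i)) * (𝓕 g z).re := fun k => by
    rw [fourier_rieszLayer, Complex.re_ofReal_mul]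
  simp only [hterm] at hsum
  refine hz1.trans_le (sum_le_hasSum _ (fun k _ => ?_) hsum)
  exact mul_nonneg (Finset.sum_nonneg fun i _ => rieszProd_nonneg k _) (hgF z hz2).le

/-- If the real part of `F` tends to infinity at `x` off a null set, then `|F - c| ≥ 1` almost
everywhere on small balls around `x`, for each `c`. -/
lemma not_isLebesguePoint_of_ae_lt_re {F : EuclideanSpace ℝ (Fin d) → ℂ}
    {x : EuclideanSpace ℝ (Fin d)}
    (h : ∀ M : ℝ, ∃ δ > 0, ∀ᵐ z, z ∈ Metric.ball x δ → M < (F z).re) :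
    ¬ IsLebesguePoint F x := by
  rintro ⟨c, hc⟩
  obtain ⟨δ, hδ, hae⟩ := h (c.re + 1)
  have hae' : ∀ᵐ y : EuclideanSpace ℝ (Fin d), x - y ∈ Metric.ball x δ → c.re + 1 < (F (x - y)).re :=
    (Measure.measurePreserving_sub_left volume x).quasiMeasurePreserving.ae hae
  set v := volume (Metric.ball (0 : EuclideanSpace ℝ (Fin d)) 1) with hv
  have hv0 : 0 < v := Metric.measure_ball_pos _ _ one_pos
  have hev : ∀ᶠ r : ℝ in 𝓝[>] 0, v ≤ ENNReal.ofReal ((r ^ d)⁻¹) *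
      ∫⁻ y in Metric.ball (0 : EuclideanSpace ℝ (Fin d)) r, ‖F (x - y) - c‖ₑ := by
    filter_upwards [Ioo_mem_nhdsGT hδ] with r hr
    have hr0 : 0 < r := hr.1
    have hlow : volume (Metric.ball (0 : EuclideanSpace ℝ (Fin d)) r) ≤
        ∫⁻ y in Metric.ball (0 : EuclideanSpace ℝ (Fin d)) r, ‖F (x - y) - c‖ₑ := by
      rw [← setLIntegral_one]
      refine lintegral_mono_ae ((ae_restrict_iff' measurableSet_ball).2 ?_)
      filter_upwards [hae'] with y hy hyr
      have h1 := hy (by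
        simp only [Metric.mem_ball, dist_zero_right] at hyr
        rw [Metric.mem_ball, dist_eq_norm, sub_sub_cancel_left, norm_neg]
        exact hyr.trans hr.2)
      have h2 : 1 ≤ ‖F (x - y) - c‖ := by
        refine le_trans ?_ (Complex.re_le_norm _)
        rw [Complex.sub_re]; linarith
      rw [← ofReal_norm, ← ENNReal.ofReal_one]
      exact ENNReal.ofReal_le_ofReal h2
    calc v = ENNReal.ofReal ((r ^ d)⁻¹) *
          volume (Metric.ball (0 : EuclideanSpace ℝ (Fin d)) r) := by
          rw [Measure.addHaar_ball_of_pos volume _ hr0, ← hv, ← mul_assoc,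
            ← ENNReal.ofReal_mul (by positivity), finrank_euclideanSpace_fin,
            inv_mul_cancel₀ (by positivity), ENNReal.ofReal_one, one_mul]
      _ ≤ _ := by gcongr
  exact absurd (ge_of_tendsto hc hev) (not_le.2 hv0)

end RieszProducts

theorem theorem1 (d : ℕ) (hd : 1 ≤ d) :
    ∃ (f : EuclideanSpace ℝ (Fin d) → ℂ)
      (hf : ∀ p : ℝ≥0∞, 1 < p → MemLp f p (volume : Measure (EuclideanSpace ℝ (Fin d))))
      (θ : ℕ → ℝ) (E : Set (EuclideanSpace ℝ (Fin d))),
      (∀ j, θ j ∈ Ioo (0 : ℝ) (1 / 2)) ∧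
      E = tensorCantorSet d θ ∧
      IsCompact E ∧
      dimH E = (d : ℝ≥0∞) ∧
      ∀ x ∈ E, ¬ IsLebesguePoint
        (𝓕 ((hf 2 ENNReal.one_lt_two).toLp f) :
          Lp ℂ 2 (volume : Measure (EuclideanSpace ℝ (Fin d)))) x := by
  obtain ⟨g, hg, hg1, hgF⟩ := exists_window d
  refine ⟨rieszSum g, fun p hp => memLp_rieszSum hg hg1 hp, ratio, tensorCantorSet d ratio,
    ratio_mem, rfl, isCompact_tensorCantorSet d ratio, dimH_tensorCantorSet hd, fun x hx => ?_⟩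
  exact not_isLebesguePoint_of_ae_lt_re
    (exists_ae_lt_re_fourier_rieszSum hg hg1 hgF (memLp_rieszSum hg hg1 ENNReal.one_lt_two) hx)
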